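/- Let $H$ be a complex Hilbert space and let $M\subseteq\mathbb B(H)$ be a von Neumann algebra. Let $M_*\subseteq M^*$ be its predual, that is, the space of normal (equivalently, $\sigma$-weakly continuous) linear functionals on $M$ with the norm of $M^*$, and let the weak* topology on $M$ be $\sigma(M,M_*)$. Call $M$ countably decomposable if every family of mutually orthogonal nonzero projections in $M$ is countable. Then the following are equivalent: 1. $M$ admits a faithful (that is, injective) normal unital $*$-representation on a separable Hilbert space; 2. $M$ is separable, i.e., $M_*$ is norm-separable; 3. $M$ is countably decomposable and $M$ is separable in the weak* topology; 4. $M$ is countably decomposable and $M$ has a norm-separable $C^*$-subalgebra which is weak*-dense in $M$; 5. $M$ is countably decomposable and $M$ is countably generated as a von Neumann algebra, i.e., there is a countable set $S\subseteq M$ such that $M$ is the smallest von Neumann algebra on $H$ containing $S$. -/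

import Mathlib

namespace VonNeumannAlgebra

universe u v

open scoped Topology

/-- The `σ`-weak (ultraweak) topology on `B(H)`: the coarsest topology for which all functionals
`T ↦ ∑ₙ ⟪ξₙ, T ηₙ⟫` with `∑ ‖ξₙ‖² < ∞` and `∑ ‖ηₙ‖² < ∞` are continuous. -/
@[reducible]
noncomputable def sigmaWeakTopology (H : Type u) [NormedAddCommGroup H] [InnerProductSpace ℂ H] :
    TopologicalSpace (H →L[ℂ] H) :=
  ⨅ (ξ : ℕ → H) (η : ℕ → H) (_ : Summable fun n => ‖ξ n‖ ^ 2) (_ : Summable fun n => ‖η n‖ ^ 2),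
    TopologicalSpace.induced (fun T : H →L[ℂ] H => ∑' n, inner ℂ (ξ n) (T (η n))) inferInstance

variable {H : Type u} [NormedAddCommGroup H] [InnerProductSpace ℂ H] [CompleteSpace H]

/-- The relative `σ`-weak topology on a von Neumann algebra `M ⊆ B(H)`. -/
@[reducible]
noncomputable def relSigmaWeak (M : VonNeumannAlgebra H) : TopologicalSpace M.toStarSubalgebra :=
  TopologicalSpace.induced (fun x => (x : H →L[ℂ] H)) (sigmaWeakTopology H)

/-- The predual `M_*` of a von Neumann algebra `M`: the space of normal (that is, `σ`-weakly
continuous) linear functionals on `M`, as a subspace of the Banach dual `M^*`; it carries the norm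
of `M^*`. -/
noncomputable def predual (M : VonNeumannAlgebra H) : Submodule ℂ (StrongDual ℂ M.toStarSubalgebra) where
  carrier := {φ | Continuous[M.relSigmaWeak, inferInstance] (fun x => φ x)}
  add_mem' hφ hψ := @Continuous.add _ _ _ _ _ M.relSigmaWeak _ _ hφ hψ
  zero_mem' := @continuous_const _ _ M.relSigmaWeak _ 0
  smul_mem' c _ hφ := @Continuous.const_smul _ _ _ _ _ _ M.relSigmaWeak _ hφ c

/-- The weak* topology `σ(M, M_*)` on a von Neumann algebra `M`. -/
@[reducible]
noncomputable def weakStarTopology (M : VonNeumannAlgebra H) : TopologicalSpace M.toStarSubalgebra :=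
  ⨅ φ : M.predual,
    TopologicalSpace.induced (fun x => (φ : StrongDual ℂ M.toStarSubalgebra) x) inferInstance

/-- A unital `*`-representation of `M` on a Hilbert space `K` is normal if it is continuous for the
weak* topology of `M` and the `σ`-weak (that is, weak*) topology of `B(K)`. -/
def IsNormalRep (M : VonNeumannAlgebra H) {K : Type v} [NormedAddCommGroup K]
    [InnerProductSpace ℂ K] [CompleteSpace K]
    (π : M.toStarSubalgebra →⋆ₐ[ℂ] (K →L[ℂ] K)) : Prop :=
  Continuous[M.weakStarTopology, sigmaWeakTopology K] (fun x => π x)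

/-- `M` admits a faithful (normal) representation on a separable Hilbert space. -/
def HasFaithfulSeparableRep (M : VonNeumannAlgebra H) : Prop :=
  ∃ (K : Type u) (_ : NormedAddCommGroup K) (_ : InnerProductSpace ℂ K) (_ : CompleteSpace K)
    (π : M.toStarSubalgebra →⋆ₐ[ℂ] (K →L[ℂ] K)),
    TopologicalSpace.SeparableSpace K ∧ Function.Injective π ∧ M.IsNormalRep π

/-- `M` is countably decomposable: every set of mutually orthogonal nonzero projections in `M` is
countable. -/
def IsCountablyDecomposable (M : VonNeumannAlgebra H) : Prop :=
  ∀ P : Set M.toStarSubalgebra, (∀ p ∈ P, IsStarProjection p ∧ p ≠ 0) →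
    P.Pairwise (fun p q => p * q = 0) → P.Countable

/-- `M` is separable in the weak* topology: it has a countable weak*-dense subset. -/
def IsWeakStarSeparable (M : VonNeumannAlgebra H) : Prop :=
  @TopologicalSpace.SeparableSpace M.toStarSubalgebra M.weakStarTopology

/-- `M` has a (not necessarily unital) `C^*`-subalgebra, that is, a norm-closed `*`-subalgebra,
which is norm-separable and weak*-dense in `M`. -/
def HasSeparableDenseCStarSubalgebra (M : VonNeumannAlgebra H) : Prop :=
  ∃ A : NonUnitalStarSubalgebra ℂ M.toStarSubalgebra,
    IsClosed (A : Set M.toStarSubalgebra) ∧ TopologicalSpace.SeparableSpace A ∧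
      @Dense _ M.weakStarTopology (A : Set M.toStarSubalgebra)

/-- `M` is countably generated as a von Neumann algebra: for some countable `S ⊆ M`, `M` is the
smallest von Neumann algebra that contains `S`. -/
def IsCountablyGenerated (M : VonNeumannAlgebra H) : Prop :=
  ∃ S : Set (H →L[ℂ] H), S.Countable ∧ S ⊆ (M : Set (H →L[ℂ] H)) ∧
    ∀ N : VonNeumannAlgebra H, S ⊆ (N : Set (H →L[ℂ] H)) → M ≤ N

end VonNeumannAlgebra

namespace VonNeumannAlgebra

open TopologicalSpace Filter
open scoped Topology

universe u

/-! The implications form a cycle 1 → 2 → 3 → 4 → 5 → 1, with two substantial ingredients.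

The first is the duality between `M` and its predual (`exists_apply_eq_of_mem_predual`): bounded
functionals act on normal functionals as elements of `M`. By Hahn–Banach, a family of normal
functionals separating the points of `M` then has norm-dense span in the predual. The matrix
coefficients of a faithful normal representation, taken over a countable dense set of vectors, form
such a family, which gives 1 → 2.

The second is a countable separating set of vectors `X`, which countable decomposability provides
through a maximal family of orthogonal cyclic subspaces of the commutant. If a countable set `S`
generates `M`, the words in `S` and its adjoints applied to `X` span a separable invariant subspace.
Restriction to it is normal, and it is faithful because `X` is separating; this gives 5 → 1. -/

/-- A closed subspace is separated from each point outside it by a bounded functional. -/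
theorem exists_dual_ne_zero_of_notMem {E : Type*} [NormedAddCommGroup E]
    [NormedSpace ℂ E] {W : Submodule ℂ E} (hW : IsClosed (W : Set E)) {x : E} (hx : x ∉ W) :
    ∃ f : StrongDual ℂ E, f x ≠ 0 ∧ ∀ w ∈ W, f w = 0 := by
  obtain ⟨f, hf⟩ := SeparatingDual.exists_ne_zero (R := ℂ)
    (x := W.mkQ x) (by simpa [Submodule.Quotient.mk_eq_zero] using hx)
  refine ⟨f ∘L W.mkQL, hf, fun w hw => ?_⟩
  have : W.mkQ w = 0 := by simpa [Submodule.Quotient.mk_eq_zero] using hw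
  exact (congrArg f this).trans (map_zero f)

/-! ### The σ-weak topology and cyclic subspaces -/

section

variable {H : Type u} [NormedAddCommGroup H] [InnerProductSpace ℂ H]

theorem continuous_tsum_inner {ξ η : ℕ → H}
    (hξ : Summable fun n => ‖ξ n‖ ^ 2) (hη : Summable fun n => ‖η n‖ ^ 2) :
    Continuous[sigmaWeakTopology H, inferInstance]
      (fun T : H →L[ℂ] H => ∑' n, inner ℂ (ξ n) (T (η n))) :=
  continuous_iInf_dom <| continuous_iInf_dom <| continuous_iInf_dom (i := hξ) <|
    continuous_iInf_dom (i := hη) continuous_induced_dom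

theorem continuous_inner_apply (ξ η : H) :
    Continuous[sigmaWeakTopology H, inferInstance] (fun T : H →L[ℂ] H => inner ℂ ξ (T η)) := by
  have hs (v : H) : Summable fun n => ‖(Pi.single 0 v : ℕ → H) n‖ ^ 2 :=
    summable_of_ne_finset_zero (s := {0}) fun n hn => by
      simp [Pi.single_eq_of_ne (show n ≠ 0 by simpa using hn)]
  convert continuous_tsum_inner (hs ξ) (hs η) using 2 with T
  rw [tsum_eq_single 0 fun n hn => by simp [Pi.single_eq_of_ne hn]]
  simp

/-- The closed linear span of the vectors `a ξ` with `a ∈ S` and `ξ ∈ X`. -/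
noncomputable def cyclicSubspace (S : Set (H →L[ℂ] H)) (X : Set H) : Submodule ℂ H :=
  (Submodule.span ℂ (Set.image2 (fun a ξ => a ξ) S X)).topologicalClosure

theorem isClosed_cyclicSubspace (S : Set (H →L[ℂ] H)) (X : Set H) :
    IsClosed (cyclicSubspace S X : Set H) :=
  Submodule.isClosed_topologicalClosure _

theorem apply_mem_cyclicSubspace {S : Set (H →L[ℂ] H)} {X : Set H} {a : H →L[ℂ] H} {ξ : H}
    (ha : a ∈ S) (hξ : ξ ∈ X) : a ξ ∈ cyclicSubspace S X :=
  Submodule.le_topologicalClosure _ (Submodule.subset_span ⟨a, ha, ξ, hξ, rfl⟩)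

theorem cyclicSubspace_le {S : Set (H →L[ℂ] H)} {X : Set H} {W : Submodule ℂ H}
    (hW : IsClosed (W : Set H)) (h : ∀ a ∈ S, ∀ ξ ∈ X, a ξ ∈ W) : cyclicSubspace S X ≤ W := by
  refine Submodule.topologicalClosure_minimal _ (Submodule.span_le.2 ?_) hW
  rintro _ ⟨a, ha, ξ, hξ, rfl⟩
  exact h a ha ξ hξ

/-- Only stability of `S` under left multiplication by `t` is needed, so this serves both the
commutant of `M` and a countable monoid of words. -/
theorem map_mem_cyclicSubspace {S : Set (H →L[ℂ] H)} {X : Set H} {t : H →L[ℂ] H}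
    (ht : ∀ s ∈ S, t * s ∈ S) {v : H} (hv : v ∈ cyclicSubspace S X) :
    t v ∈ cyclicSubspace S X := by
  have : cyclicSubspace S X ≤ (cyclicSubspace S X).comap t.toLinearMap :=
    cyclicSubspace_le ((isClosed_cyclicSubspace S X).preimage t.continuous)
      fun a ha ξ hξ => apply_mem_cyclicSubspace (a := t * a) (ht a ha) hξ
  exact this hv

theorem separableSpace_cyclicSubspace {S : Set (H →L[ℂ] H)} {X : Set H}
    (hS : S.Countable) (hX : X.Countable) : SeparableSpace (cyclicSubspace S X) := by
  have : IsSeparable (cyclicSubspace S X : Set H) :=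
    ((hS.image2 hX _).isSeparable.span (R := ℂ)).closure
  exact this.separableSpace

end

variable {H : Type u} [NormedAddCommGroup H] [InnerProductSpace ℂ H] [CompleteSpace H]

/-! ### Normal functionals and the duality with the predual -/

/-- A bounded sesquilinear form on a Hilbert space is given by a bounded operator. -/
theorem exists_inner_apply_eq (B : H → H → ℂ)
    (add_left : ∀ v₁ v₂ w, B (v₁ + v₂) w = B v₁ w + B v₂ w)
    (smul_left : ∀ c v w, B (c • v) w = starRingEnd ℂ c * B v w)
    (add_right : ∀ v w₁ w₂, B v (w₁ + w₂) = B v w₁ + B v w₂)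
    (smul_right : ∀ c v w, B v (c • w) = c * B v w)
    {C : ℝ} (bound : ∀ v w, ‖B v w‖ ≤ C * ‖v‖ * ‖w‖) :
    ∃ T : H →L[ℂ] H, ∀ v w, inner ℂ v (T w) = B v w := by
  let B' : H →L⋆[ℂ] H →L[ℂ] ℂ := LinearMap.mkContinuous₂
    (LinearMap.mk₂'ₛₗ (starRingEnd ℂ) (RingHom.id ℂ) B add_left smul_left add_right smul_right)
    C bound
  refine ⟨ContinuousLinearMap.adjoint (InnerProductSpace.continuousLinearMapOfBilin B'),
    fun v w => ?_⟩
  rw [ContinuousLinearMap.adjoint_inner_right,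
    InnerProductSpace.continuousLinearMapOfBilin_apply]
  rfl

/-- The vector functional `x ↦ ⟪ξ, x η⟫` on a von Neumann algebra. -/
noncomputable def vectorFunctional (M : VonNeumannAlgebra H) (ξ η : H) :
    StrongDual ℂ M.toStarSubalgebra :=
  LinearMap.mkContinuous
    { toFun := fun x => inner ℂ ξ ((x : H →L[ℂ] H) η)
      map_add' := fun x y => by simp
      map_smul' := fun c x => by simp }
    (‖ξ‖ * ‖η‖) fun x => by
      calc ‖inner ℂ ξ ((x : H →L[ℂ] H) η)‖ ≤ ‖ξ‖ * ‖(x : H →L[ℂ] H) η‖ := norm_inner_le_norm _ _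
        _ ≤ ‖ξ‖ * (‖x‖ * ‖η‖) := by gcongr; exact (x : H →L[ℂ] H).le_opNorm η
        _ = ‖ξ‖ * ‖η‖ * ‖x‖ := by ring

@[simp]
theorem vectorFunctional_apply (M : VonNeumannAlgebra H) (ξ η : H) (x : M.toStarSubalgebra) :
    M.vectorFunctional ξ η x = inner ℂ ξ ((x : H →L[ℂ] H) η) :=
  rfl

theorem vectorFunctional_add_left (M : VonNeumannAlgebra H) (ξ₁ ξ₂ η : H) :
    M.vectorFunctional (ξ₁ + ξ₂) η = M.vectorFunctional ξ₁ η + M.vectorFunctional ξ₂ η := by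
  ext x
  exact inner_add_left _ _ _

theorem vectorFunctional_add_right (M : VonNeumannAlgebra H) (ξ η₁ η₂ : H) :
    M.vectorFunctional ξ (η₁ + η₂) = M.vectorFunctional ξ η₁ + M.vectorFunctional ξ η₂ := by
  ext x
  simp

theorem vectorFunctional_smul_left (M : VonNeumannAlgebra H) (c : ℂ) (ξ η : H) :
    M.vectorFunctional (c • ξ) η = starRingEnd ℂ c • M.vectorFunctional ξ η := by
  ext x
  exact inner_smul_left _ _ _

theorem vectorFunctional_smul_right (M : VonNeumannAlgebra H) (c : ℂ) (ξ η : H) :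
    M.vectorFunctional ξ (c • η) = c • M.vectorFunctional ξ η := by
  ext x
  simp

theorem norm_vectorFunctional_le (M : VonNeumannAlgebra H) (ξ η : H) :
    ‖M.vectorFunctional ξ η‖ ≤ ‖ξ‖ * ‖η‖ :=
  LinearMap.mkContinuous_norm_le _ (by positivity) _

theorem summable_vectorFunctional (M : VonNeumannAlgebra H) {ξ η : ℕ → H}
    (hξ : Summable fun n => ‖ξ n‖ ^ 2) (hη : Summable fun n => ‖η n‖ ^ 2) :
    Summable fun n => M.vectorFunctional (ξ n) (η n) := by
  refine Summable.of_norm_bounded (hξ.add hη) fun n => (M.norm_vectorFunctional_le _ _).trans ?_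
  nlinarith [sq_nonneg (‖ξ n‖ - ‖η n‖), sq_nonneg ‖ξ n‖, sq_nonneg ‖η n‖]

theorem tsum_vectorFunctional_apply (M : VonNeumannAlgebra H) {ξ η : ℕ → H}
    (hξ : Summable fun n => ‖ξ n‖ ^ 2) (hη : Summable fun n => ‖η n‖ ^ 2)
    (x : M.toStarSubalgebra) :
    (∑' n, M.vectorFunctional (ξ n) (η n)) x = ∑' n, inner ℂ (ξ n) ((x : H →L[ℂ] H) (η n)) :=
  (ContinuousLinearMap.apply ℂ ℂ x).map_tsum (M.summable_vectorFunctional hξ hη)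

theorem continuous_coe_relSigmaWeak (M : VonNeumannAlgebra H) :
    Continuous[M.relSigmaWeak, sigmaWeakTopology H]
      (fun x : M.toStarSubalgebra => (x : H →L[ℂ] H)) :=
  continuous_induced_dom

theorem tsum_vectorFunctional_mem_predual (M : VonNeumannAlgebra H) {ξ η : ℕ → H}
    (hξ : Summable fun n => ‖ξ n‖ ^ 2) (hη : Summable fun n => ‖η n‖ ^ 2) :
    ∑' n, M.vectorFunctional (ξ n) (η n) ∈ M.predual := by
  change Continuous[M.relSigmaWeak, inferInstance] _
  simp only [M.tsum_vectorFunctional_apply hξ hη]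
  exact @Continuous.comp _ _ _ M.relSigmaWeak (sigmaWeakTopology H) _ _ _
    (continuous_tsum_inner hξ hη) M.continuous_coe_relSigmaWeak

theorem vectorFunctional_mem_predual (M : VonNeumannAlgebra H) (ξ η : H) :
    M.vectorFunctional ξ η ∈ M.predual :=
  @Continuous.comp _ _ _ M.relSigmaWeak (sigmaWeakTopology H) _ _ _
    (continuous_inner_apply ξ η) M.continuous_coe_relSigmaWeak

theorem continuous_weakStar (M : VonNeumannAlgebra H) {φ : StrongDual ℂ M.toStarSubalgebra}
    (hφ : φ ∈ M.predual) : Continuous[M.weakStarTopology, inferInstance] (fun x => φ x) :=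
  continuous_iInf_dom (i := (⟨φ, hφ⟩ : M.predual)) continuous_induced_dom

/-- This lets weak* continuity, as in `IsNormalRep`, yield the σ-weak continuity that defines the
predual. -/
theorem relSigmaWeak_le_weakStar (M : VonNeumannAlgebra H) :
    M.relSigmaWeak ≤ M.weakStarTopology :=
  le_iInf fun φ => continuous_iff_le_induced.1 φ.2

theorem norm_le_relSigmaWeak (M : VonNeumannAlgebra H) :
    (inferInstance : TopologicalSpace M.toStarSubalgebra) ≤ M.relSigmaWeak := by
  simp only [relSigmaWeak, sigmaWeakTopology, induced_iInf, induced_compose, le_iInf_iff]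
  intro ξ η hξ hη
  rw [← continuous_iff_le_induced]
  convert (∑' n, M.vectorFunctional (ξ n) (η n)).continuous using 1
  ext x
  exact (M.tsum_vectorFunctional_apply hξ hη x).symm

/-- Every normal functional is a norm limit of linear combinations of vector functionals. -/
theorem predual_le_closure_span (M : VonNeumannAlgebra H) :
    M.predual ≤ (Submodule.span ℂ
      (Set.range fun p : H × H => M.vectorFunctional p.1 p.2)).topologicalClosure := by
  intro φ hφ
  let ι := {p : (ℕ → H) × (ℕ → H) //
    (Summable fun n => ‖p.1 n‖ ^ 2) ∧ Summable fun n => ‖p.2 n‖ ^ 2}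
  let s : ι → StrongDual ℂ M.toStarSubalgebra := fun p =>
    ∑' n, M.vectorFunctional (p.1.1 n) (p.1.2 n)
  -- A linear functional continuous for the topology induced by a family of functionals is a finite
  -- linear combination of them.
  have hs : φ.toLinearMap ∈ Submodule.span ℂ (Set.range fun p => (s p).toLinearMap) := by
    rw [LinearMap.mem_span_iff_continuous]
    refine continuous_le_dom ?_ (show Continuous[M.relSigmaWeak, inferInstance] _ from hφ)
    simp only [relSigmaWeak, sigmaWeakTopology, induced_iInf, induced_compose, le_iInf_iff]
    intro ξ η hξ hη
    refine (iInf_le _ (⟨(ξ, η), hξ, hη⟩ : ι)).trans (le_of_eq ?_)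
    congr 1
    ext x
    exact M.tsum_vectorFunctional_apply hξ hη x
  have hs' : φ ∈ Submodule.span ℂ (Set.range s) := by
    have : Set.range (fun p => (s p).toLinearMap) =
        ContinuousLinearMap.coeLM ℂ '' Set.range s := by
      rw [← Set.range_comp]; rfl
    rw [this, Submodule.span_image] at hs
    obtain ⟨ψ, hψ, h⟩ := hs
    rwa [← ContinuousLinearMap.coe_injective h]
  refine Submodule.span_le.2 ?_ hs'
  rintro _ ⟨p, rfl⟩
  refine (Submodule.isClosed_topologicalClosure _).mem_of_tendsto
    (M.summable_vectorFunctional p.2.1 p.2.2).hasSum (.of_forall fun t => ?_)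
  exact Submodule.sum_mem _ fun n _ =>
    Submodule.le_topologicalClosure _ (Submodule.subset_span ⟨(_, _), rfl⟩)

/-- Every bounded functional on the predual is evaluation at an element of `M`. -/
theorem exists_apply_eq_of_mem_predual (M : VonNeumannAlgebra H)
    (Φ : StrongDual ℂ (StrongDual ℂ M.toStarSubalgebra)) :
    ∃ x : M.toStarSubalgebra, ∀ φ ∈ M.predual, Φ φ = φ x := by
  have hΦ (v w : H) : ‖Φ (M.vectorFunctional v w)‖ ≤ ‖Φ‖ * ‖v‖ * ‖w‖ := by
    rw [mul_assoc]
    exact (Φ.le_opNorm _).trans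
      (mul_le_mul_of_nonneg_left (M.norm_vectorFunctional_le v w) (norm_nonneg _))
  obtain ⟨T, hT⟩ := exists_inner_apply_eq (fun v w => Φ (M.vectorFunctional v w))
    (fun v₁ v₂ w => by rw [vectorFunctional_add_left, map_add])
    (fun c v w => by rw [vectorFunctional_smul_left, map_smul, smul_eq_mul])
    (fun v w₁ w₂ => by rw [vectorFunctional_add_right, map_add])
    (fun c v w => by rw [vectorFunctional_smul_right, map_smul, smul_eq_mul]) hΦ
  -- For `y` in the commutant, the pairs `(y* v, w)` and `(v, y w)` define the same functional on
  -- `M`, so `T` commutes with `y`; the bicommutant property gives `T ∈ M`.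
  have hTM : T ∈ M := by
    rw [← M.commutant_commutant, mem_commutant_iff]
    intro y hy
    ext w
    refine ext_inner_left ℂ fun v => ?_
    rw [mul_apply_eq_comp, mul_apply_eq_comp,
      ← ContinuousLinearMap.adjoint_inner_left, hT, hT]
    congr 1
    ext x
    rw [vectorFunctional_apply, vectorFunctional_apply, ContinuousLinearMap.adjoint_inner_left]
    exact congrArg (inner ℂ v) (DFunLike.congr_fun (mem_commutant_iff.1 hy x x.2) w).symm
  refine ⟨⟨T, hTM⟩, fun φ hφ => ?_⟩
  let Ψ : StrongDual ℂ (StrongDual ℂ M.toStarSubalgebra) :=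
    ContinuousLinearMap.apply ℂ ℂ (⟨T, hTM⟩ : M.toStarSubalgebra)
  have hcl : IsClosed ((Φ - Ψ).ker : Set (StrongDual ℂ M.toStarSubalgebra)) :=
    (Φ - Ψ).isClosed_ker
  have hmem : φ ∈ (Φ - Ψ).ker := by
    refine Submodule.topologicalClosure_minimal _ (Submodule.span_le.2 ?_) hcl
      (M.predual_le_closure_span hφ)
    rintro _ ⟨p, rfl⟩
    exact sub_eq_zero.2 (hT p.1 p.2).symm
  exact sub_eq_zero.1 hmem

/-- A set of functionals that separates the points of `M` spans a norm-dense subspace of the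
predual. -/
theorem predual_le_closure_span_of_separating (M : VonNeumannAlgebra H)
    {s : Set (StrongDual ℂ M.toStarSubalgebra)} (hs : s ⊆ M.predual)
    (hsep : ∀ x : M.toStarSubalgebra, (∀ φ ∈ s, φ x = 0) → x = 0) :
    M.predual ≤ (Submodule.span ℂ s).topologicalClosure := by
  intro φ hφ
  by_contra hφs
  obtain ⟨f, hf, hfs⟩ :=
    exists_dual_ne_zero_of_notMem (Submodule.isClosed_topologicalClosure _) hφs
  obtain ⟨x, hx⟩ := M.exists_apply_eq_of_mem_predual f
  have hx0 : x = 0 := hsep x fun ψ hψ => by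
    rw [← hx ψ (hs hψ)]
    exact hfs ψ (Submodule.le_topologicalClosure _ (Submodule.subset_span hψ))
  exact hf (by rw [hx φ hφ, hx0, map_zero])

/-! ### Separability of the predual and its consequences -/

theorem separableSpace_predual_of_hasFaithfulSeparableRep {M : VonNeumannAlgebra H}
    (h : M.HasFaithfulSeparableRep) : SeparableSpace M.predual := by
  obtain ⟨K, _, _, _, π, hK, hinj, hπ⟩ := h
  have hcont (ξ η : K) : Continuous[M.relSigmaWeak, inferInstance]
      (fun x : M.toStarSubalgebra => inner ℂ ξ (π x η)) :=
    continuous_le_dom M.relSigmaWeak_le_weakStar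
      (@Continuous.comp _ _ _ M.weakStarTopology (sigmaWeakTopology K) _ _ _
        (continuous_inner_apply ξ η) hπ)
  let ω (p : K × K) : StrongDual ℂ M.toStarSubalgebra :=
    { toFun := fun x => inner ℂ p.1 (π x p.2)
      map_add' := fun x y => by simp
      map_smul' := fun c x => by simp
      cont := continuous_le_dom M.norm_le_relSigmaWeak (hcont p.1 p.2) }
  obtain ⟨D, hDc, hD⟩ := exists_countable_dense K
  have hle := M.predual_le_closure_span_of_separating (s := ω '' (D ×ˢ D))
    (by rintro _ ⟨p, -, rfl⟩; exact hcont p.1 p.2)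
    (fun x hx => hinj (by
      rw [map_zero]
      refine ContinuousLinearMap.ext_on (s := D) (hD.mono Submodule.subset_span) fun η hη => ?_
      exact hD.eq_zero_of_inner_right ℂ fun ξ hξ =>
        hx _ (Set.mem_image_of_mem ω (Set.mk_mem_prod hξ hη))))
  have hsep : IsSeparable (M.predual : Set (StrongDual ℂ M.toStarSubalgebra)) :=
    ((((hDc.prod hDc).image ω).isSeparable.span (R := ℂ)).closure).mono hle
  exact hsep.separableSpace

/-- Unit vectors in the ranges of orthogonal projections give vector functionals at mutual distance
at least 1, as the projections themselves witness. A separable space has only countably many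
disjoint balls of radius 1/2. -/
theorem isCountablyDecomposable_of_separableSpace_predual {M : VonNeumannAlgebra H}
    (h : SeparableSpace M.predual) : M.IsCountablyDecomposable := by
  intro P hP hPo
  have hex (p : M.toStarSubalgebra) : ∃ ξ : H, p ∈ P → ‖ξ‖ = 1 ∧ (p : H →L[ℂ] H) ξ = ξ := by
    by_cases hp : p ∈ P
    · obtain ⟨η, hη⟩ : ∃ η : H, (p : H →L[ℂ] H) η ≠ 0 := by
        by_contra! hcon
        exact (hP p hp).2 (Subtype.ext (ContinuousLinearMap.ext hcon))
      have hidem : (p : H →L[ℂ] H) ((p : H →L[ℂ] H) η) = (p : H →L[ℂ] H) η :=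
        DFunLike.congr_fun (congrArg Subtype.val (hP p hp).1.isIdempotentElem) η
      refine ⟨((‖(p : H →L[ℂ] H) η‖⁻¹ : ℝ) : ℂ) • (p : H →L[ℂ] H) η, fun _ => ⟨?_, ?_⟩⟩
      · rw [norm_smul]
        simp [hη]
      · rw [map_smul, hidem]
    · exact ⟨0, fun h => (hp h).elim⟩
  choose ξ hξ using hex
  let ω (p : M.toStarSubalgebra) : M.predual :=
    ⟨M.vectorFunctional (ξ p) (ξ p), M.vectorFunctional_mem_predual _ _⟩
  have hsep {p q : M.toStarSubalgebra} (hp : p ∈ P) (hq : q ∈ P) (hpq : p ≠ q) :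
      1 ≤ dist (ω p) (ω q) := by
    have hp1 : ‖p‖ ≤ 1 := (hP p hp).1.norm_le
    have hv : ((ω p : StrongDual ℂ M.toStarSubalgebra) - ω q) p = 1 := by
      have h0 : (p : H →L[ℂ] H) (ξ q) = 0 := by
        rw [← (hξ q hq).2]
        exact DFunLike.congr_fun (congrArg Subtype.val (hPo hp hq hpq)) (ξ q)
      rw [sub_apply]
      simp [ω, h0, (hξ p hp).2, (hξ p hp).1]
    calc (1 : ℝ) = ‖((ω p : StrongDual ℂ M.toStarSubalgebra) - ω q) p‖ := by rw [hv, norm_one]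
      _ ≤ ‖(ω p : StrongDual ℂ M.toStarSubalgebra) - ω q‖ * ‖p‖ :=
        ContinuousLinearMap.le_opNorm _ _
      _ ≤ ‖(ω p : StrongDual ℂ M.toStarSubalgebra) - ω q‖ * 1 :=
        mul_le_mul_of_nonneg_left hp1 (norm_nonneg _)
      _ = dist (ω p) (ω q) := (mul_one _).trans (dist_eq_norm (ω p) (ω q)).symm
  refine Set.PairwiseDisjoint.countable_of_isOpen (s := fun p => Metric.ball (ω p) (1 / 2))
    (fun p hp q hq hpq => Metric.ball_disjoint_ball ?_) (fun _ _ => Metric.isOpen_ball)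
    (fun _ _ => ⟨_, Metric.mem_ball_self (by norm_num)⟩)
  have := hsep hp hq hpq
  linarith

/-- A net in `M` converges in the weak* topology as soon as all normal functionals converge
along it. -/
theorem tendsto_weakStar (M : VonNeumannAlgebra H) {α : Type*} {l : Filter α}
    {f : α → M.toStarSubalgebra} {x : M.toStarSubalgebra}
    (h : ∀ φ ∈ M.predual, Tendsto (fun a => φ (f a)) l (𝓝 (φ x))) :
    Tendsto f l (@nhds _ M.weakStarTopology x) := by
  rw [weakStarTopology, nhds_iInf, tendsto_iInf]
  intro φ
  rw [nhds_induced, tendsto_comap_iff]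
  exact h φ φ.2

/-- Convergence of a bounded sequence on a dense sequence of functionals implies convergence on
all functionals. -/
theorem tendsto_apply_of_dense {E : Type*} [NormedAddCommGroup E] [NormedSpace ℂ E]
    {V : Submodule ℂ (StrongDual ℂ E)} {φ : ℕ → V} (hφ : DenseRange φ)
    {f : ℕ → E} {x : E} {C : ℝ} (hf : ∀ k, ‖f k‖ ≤ C) (hx : ‖x‖ ≤ C)
    (h : ∀ n, Tendsto (fun k => (φ n : StrongDual ℂ E) (f k)) atTop
      (𝓝 ((φ n : StrongDual ℂ E) x))) {ψ : StrongDual ℂ E} (hψ : ψ ∈ V) :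
    Tendsto (fun k => ψ (f k)) atTop (𝓝 (ψ x)) := by
  have hC : 0 ≤ C := (norm_nonneg x).trans hx
  rw [Metric.tendsto_atTop]
  intro ε hε
  -- The bound `C` may be 0; `C + 1` keeps the denominator positive.
  obtain ⟨n, hn⟩ := hφ.exists_dist_lt (⟨ψ, hψ⟩ : V) (show 0 < ε / (3 * (C + 1)) by positivity)
  have hd : ‖ψ - φ n‖ < ε / (3 * (C + 1)) :=
    (dist_eq_norm (⟨ψ, hψ⟩ : V) (φ n)).symm.trans_lt hn
  have hb (y : E) (hy : ‖y‖ ≤ C) : ‖ψ y - (φ n : StrongDual ℂ E) y‖ < ε / 3 := by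
    calc ‖ψ y - (φ n : StrongDual ℂ E) y‖ ≤ ‖ψ - φ n‖ * ‖y‖ := (ψ - φ n).le_opNorm y
      _ ≤ ‖ψ - φ n‖ * (C + 1) := by gcongr; linarith
      _ < ε / (3 * (C + 1)) * (C + 1) := by gcongr
      _ = ε / 3 := by field_simp
  obtain ⟨N, hN⟩ := Metric.tendsto_atTop.1 (h n) (ε / 3) (by positivity)
  refine ⟨N, fun k hk => ?_⟩
  have h1 := hb (f k) (hf k)
  have h2 := hN k hk
  have h3 := hb x hx
  rw [← dist_eq_norm] at h1 h3
  rw [dist_comm] at h3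
  have := dist_triangle4 (ψ (f k)) ((φ n : StrongDual ℂ E) (f k)) ((φ n : StrongDual ℂ E) x) (ψ x)
  linarith

/-- Evaluation on a dense sequence of functionals maps `M` into `ℕ → ℂ`, all of whose subsets are
separable. On bounded sequences, convergence there is weak* convergence, so each ball is treated
separately. -/
theorem isWeakStarSeparable_of_separableSpace_predual {M : VonNeumannAlgebra H}
    (h : SeparableSpace M.predual) : M.IsWeakStarSeparable := by
  let φ : ℕ → M.predual := denseSeq M.predual
  have hφ : DenseRange φ := denseRange_denseSeq _
  let ev (x : M.toStarSubalgebra) : ℕ → ℂ := fun n => (φ n : StrongDual ℂ M.toStarSubalgebra) x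
  have hex (N : ℕ) : ∃ D ⊆ Metric.closedBall (0 : M.toStarSubalgebra) N, D.Countable ∧
      ev '' Metric.closedBall 0 N ⊆ closure (ev '' D) := by
    obtain ⟨c, hcs, hcc, hc⟩ := (IsSeparable.of_separableSpace
      (ev '' Metric.closedBall (0 : M.toStarSubalgebra) N)).exists_countable_dense_subset
    have hpre : ∀ y ∈ c, ∃ x ∈ Metric.closedBall (0 : M.toStarSubalgebra) N, ev x = y :=
      fun y hy => hcs hy
    choose! g hg hgc using hpre
    refine ⟨g '' c, Set.image_subset_iff.2 hg, hcc.image g, hc.trans (closure_mono fun y hy => ?_)⟩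
    exact ⟨g y, Set.mem_image_of_mem g hy, hgc y hy⟩
  choose D hD hDc hDd using hex
  refine @SeparableSpace.mk _ M.weakStarTopology ⟨⋃ N, D N, Set.countable_iUnion hDc, fun x => ?_⟩
  obtain ⟨N, hN⟩ := exists_nat_ge ‖x‖
  obtain ⟨d, hd, hdx⟩ := mem_closure_iff_seq_limit.1
    (hDd N (Set.mem_image_of_mem ev (mem_closedBall_zero_iff.2 hN)))
  choose f hfD hf using hd
  refine @mem_closure_of_tendsto _ M.weakStarTopology _ _ _ f atTop _ (M.tendsto_weakStar
    fun ψ hψ => tendsto_apply_of_dense hφ (C := N)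
      (fun k => mem_closedBall_zero_iff.1 (hD N (hfD k))) hN (fun n => ?_) hψ)
    (.of_forall fun k => Set.mem_iUnion.2 ⟨N, hfD k⟩)
  have := tendsto_pi_nhds.1 hdx n
  simpa only [← hf] using this

/-! ### From weak* separability to countable generation -/

theorem _root_.Set.Countable.submonoidClosure {A : Type*} [Monoid A] {s : Set A}
    (hs : s.Countable) : (Submonoid.closure s : Set A).Countable := by
  have := hs.to_subtype
  rw [Submonoid.closure_eq_mrange, MonoidHom.coe_mrange]
  exact Set.countable_range _

theorem hasSeparableDenseCStarSubalgebra_of_isWeakStarSeparable {M : VonNeumannAlgebra H}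
    (h : M.IsWeakStarSeparable) : M.HasSeparableDenseCStarSubalgebra := by
  obtain ⟨D, hDc, hD⟩ := h
  refine ⟨(NonUnitalStarAlgebra.adjoin ℂ D).topologicalClosure,
    NonUnitalStarSubalgebra.isClosed_topologicalClosure _, ?_, ?_⟩
  · have hc : (D ∪ star D).Countable := hDc.union (by
      rw [← Set.image_star]; exact hDc.image _)
    have hs : IsSeparable (NonUnitalStarAlgebra.adjoin ℂ D : Set M.toStarSubalgebra) := by
      have h1 := NonUnitalStarAlgebra.adjoin_eq_span (R := ℂ) D
      have h2 : (NonUnitalStarAlgebra.adjoin ℂ D : Set M.toStarSubalgebra) =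
          Submodule.span ℂ (Subsemigroup.closure (D ∪ star D) : Set M.toStarSubalgebra) :=
        congrArg (fun V : Submodule ℂ M.toStarSubalgebra => (V : Set M.toStarSubalgebra)) h1
      rw [h2]
      refine (hc.submonoidClosure.mono ?_).isSeparable.span
      exact Subsemigroup.closure_le (S := (Submonoid.closure (D ∪ star D)).toSubsemigroup).2
        Submonoid.subset_closure
    have hs' : IsSeparable
        ((NonUnitalStarAlgebra.adjoin ℂ D).topologicalClosure : Set M.toStarSubalgebra) :=
      hs.closure
    exact hs'.separableSpace
  · refine @Dense.mono _ M.weakStarTopology _ _ ?_ hD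
    exact (NonUnitalStarAlgebra.subset_adjoin ℂ D).trans
      (NonUnitalStarSubalgebra.le_topologicalClosure _)

theorem isCountablyGenerated_of_hasSeparableDenseCStarSubalgebra {M : VonNeumannAlgebra H}
    (h : M.HasSeparableDenseCStarSubalgebra) : M.IsCountablyGenerated := by
  obtain ⟨A, -, hA, hd⟩ := h
  obtain ⟨c, hcA, hcc, hc⟩ := (IsSeparable.of_subtype
    (A : Set M.toStarSubalgebra)).exists_countable_dense_subset
  refine ⟨Subtype.val '' c, hcc.image _, ?_, fun N hN => ?_⟩
  · rintro _ ⟨x, -, rfl⟩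
    exact x.2
  intro x hx
  rw [← N.commutant_commutant, mem_commutant_iff]
  intro y hy
  have hcy (z : M.toStarSubalgebra) (hz : z ∈ c) : y * (z : H →L[ℂ] H) = z * y :=
    (mem_commutant_iff.1 hy z (hN ⟨z, hz, rfl⟩)).symm
  have hAy (z : M.toStarSubalgebra) (hz : z ∈ A) : y * (z : H →L[ℂ] H) = z * y := by
    have hcl : IsClosed {z : M.toStarSubalgebra | y * (z : H →L[ℂ] H) = z * y} :=
      isClosed_eq (by fun_prop) (by fun_prop)
    exact closure_minimal hcy hcl (hc hz)
  ext w
  refine ext_inner_left ℂ fun v => ?_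
  -- Between fixed vectors, commutation with `y` equates two normal functionals, hence is a weak*
  -- closed condition.
  have hcl : @IsClosed _ M.weakStarTopology {z : M.toStarSubalgebra |
      M.vectorFunctional (ContinuousLinearMap.adjoint y v) w z =
        M.vectorFunctional v (y w) z} :=
    @isClosed_eq _ _ _ M.weakStarTopology _ _ _
      (M.continuous_weakStar (M.vectorFunctional_mem_predual _ _))
      (M.continuous_weakStar (M.vectorFunctional_mem_predual _ _))
  have hsub := @closure_minimal _ M.weakStarTopology _ _ (fun z hz => by
    change inner ℂ _ _ = inner ℂ _ _
    rw [ContinuousLinearMap.adjoint_inner_left]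
    exact congrArg (inner ℂ v) (DFunLike.congr_fun (hAy z hz) w)) hcl
  rw [mul_apply_eq_comp, ← ContinuousLinearMap.adjoint_inner_left]
  exact hsub (hd ⟨x, hx⟩)

/-! ### Separating vectors from countable decomposability -/

instance (S : Set (H →L[ℂ] H)) (X : Set H) : CompleteSpace (cyclicSubspace S X) :=
  (isClosed_cyclicSubspace S X).completeSpace_coe

/-- The projection onto a subspace invariant under a self-adjoint set of operators commutes with
this set. -/
theorem starProjection_mem_centralizer {K : Submodule ℂ H} [K.HasOrthogonalProjection]
    {T : Set (H →L[ℂ] H)} (hstar : ∀ t ∈ T, star t ∈ T) (hK : ∀ t ∈ T, ∀ v ∈ K, t v ∈ K) :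
    K.starProjection ∈ Set.centralizer T := by
  intro t ht
  ext v
  -- Since `star t` preserves `K`, `t` preserves its orthogonal complement.
  refine (Submodule.eq_starProjection_of_mem_of_inner_eq_zero
    (hK t ht _ (K.starProjection_apply_mem v)) fun w hw => ?_).symm
  change inner ℂ (t v - t (K.starProjection v)) w = 0
  rw [← map_sub, ← ContinuousLinearMap.adjoint_inner_right]
  exact Submodule.starProjection_inner_eq_zero v _ (hK _ (hstar t ht) w hw)

/-- In a countably decomposable von Neumann algebra there is a countable separating set of
vectors. -/
theorem IsCountablyDecomposable.exists_countable_separating {M : VonNeumannAlgebra H}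
    (h : M.IsCountablyDecomposable) :
    ∃ X : Set H, X.Countable ∧ ∀ x ∈ M, (∀ ξ ∈ X, x ξ = 0) → x = 0 := by
  -- The pairwise condition says that the cyclic subspaces of the commutant generated by distinct
  -- vectors are orthogonal; their projections lie in `M`.
  obtain ⟨X, hX⟩ := zorn_subset {X : Set H | (0 : H) ∉ X ∧
      X.Pairwise fun ξ η => ∀ y ∈ M.commutant, inner ℂ ξ (y η) = 0} fun c hc hchain => by
    refine ⟨⋃₀ c, ⟨?_, ?_⟩, fun s hs => Set.subset_sUnion_of_mem hs⟩
    · rintro ⟨s, hs, h0⟩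
      exact (hc hs).1 h0
    · exact (Set.pairwise_sUnion hchain.directedOn).2 fun s hs => (hc hs).2
  obtain ⟨⟨h0, hpw⟩, hmax⟩ := hX
  refine ⟨X, ?_, fun x hx hxX => ?_⟩
  · have hmem (ξ : H) : (cyclicSubspace (M.commutant : Set (H →L[ℂ] H)) {ξ}).starProjection ∈ M := by
      rw [← SetLike.mem_coe, ← M.centralizer_centralizer, ← coe_commutant]
      exact starProjection_mem_centralizer (fun t ht => star_mem ht) fun t ht v hv =>
        map_mem_cyclicSubspace (fun s hs => mul_mem ht hs) hv
    let p (ξ : H) : M.toStarSubalgebra := ⟨_, hmem ξ⟩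
    have hfix (ξ : H) : (p ξ : H →L[ℂ] H) ξ = ξ :=
      Submodule.starProjection_eq_self_iff.2
        (apply_mem_cyclicSubspace (a := 1) (one_mem M.commutant) rfl)
    have hmul {ξ η : H} (hξ : ξ ∈ X) (hη : η ∈ X) (hne : ξ ≠ η) : p ξ * p η = 0 := by
      refine Subtype.ext (Submodule.IsOrtho.starProjection_comp_starProjection ?_)
      refine cyclicSubspace_le (Submodule.isClosed_orthogonal _) ?_
      intro a ha ξ' hξ'
      rw [Set.mem_singleton_iff.1 hξ']
      rw [Submodule.mem_orthogonal']
      intro v hv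
      refine cyclicSubspace_le (W := (innerSL ℂ (a ξ)).ker)
        ((innerSL ℂ (a ξ)).isClosed_ker) ?_ hv
      intro b hb η' hη'
      rw [Set.mem_singleton_iff.1 hη']
      change inner ℂ (a ξ) (b η) = 0
      rw [← ContinuousLinearMap.adjoint_inner_right]
      exact hpw hξ hη hne _ (mul_mem (star_mem ha) hb)
    have hne {ξ : H} (hξ : ξ ∈ X) : p ξ ≠ 0 := fun hp => h0 <| by
      have := hfix ξ
      rw [hp] at this
      exact (show (0 : H) = ξ from this) ▸ hξ
    have hinj : Set.InjOn p X := fun ξ hξ η hη hpq => by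
      by_contra hcon
      have hz := hmul hξ hη hcon
      rw [← hpq, ← Subtype.coe_inj] at hz
      refine hne hξ (Subtype.ext ?_)
      exact (Submodule.isIdempotentElem_starProjection _).symm.trans hz
    refine Set.countable_of_injective_of_countable_image hinj (h _ ?_ ?_)
    · rintro _ ⟨ξ, hξ, rfl⟩
      refine ⟨⟨Subtype.ext (Submodule.isIdempotentElem_starProjection _), Subtype.ext ?_⟩, hne hξ⟩
      exact isStarProjection_starProjection.isSelfAdjoint
    · rintro _ ⟨ξ, hξ, rfl⟩ _ ⟨η, hη, rfl⟩ hpq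
      exact hmul hξ hη fun hh => hpq (congrArg p hh)
  -- If `x` kills `X`, it kills every `y ξ` with `y` in the commutant and `ξ ∈ X`, so `star x v` is
  -- orthogonal to all of these. Maximality puts `star x v` in `X`, making it orthogonal to itself.
  · by_contra hx0
    obtain ⟨v, hv⟩ : ∃ v, star x v ≠ 0 := by
      by_contra! hcon
      exact hx0 (star_eq_zero.1 (ContinuousLinearMap.ext hcon))
    have hort {ξ : H} (hξ : ξ ∈ X) {y : H →L[ℂ] H} (hy : y ∈ M.commutant) :
        inner ℂ (star x v) (y ξ) = 0 := by
      rw [ContinuousLinearMap.star_eq_adjoint, ContinuousLinearMap.adjoint_inner_left]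
      have : x (y ξ) = y (x ξ) := DFunLike.congr_fun (mem_commutant_iff.1 hy x hx) ξ
      rw [this, hxX ξ hξ, map_zero, inner_zero_right]
    have hins : insert (star x v) X ⊆ X := hmax ⟨by simpa [h0] using hv.symm, by
      refine hpw.insert fun ξ hξ _ => ⟨fun y hy => hort hξ hy, fun y hy => ?_⟩
      rw [← ContinuousLinearMap.adjoint_inner_left, ← inner_conj_symm]
      rw [show inner ℂ (star x v) (ContinuousLinearMap.adjoint y ξ) = (0 : ℂ) from
        hort hξ (star_mem hy), map_zero]⟩ (Set.subset_insert _ _)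
    have hin : star x v ∈ X := hins (Set.mem_insert _ _)
    refine hv (inner_self_eq_zero (𝕜 := ℂ).1 ?_)
    exact hort hin (one_mem M.commutant)

/-! ### Restriction to a separable invariant subspace -/

/-- The restriction of a von Neumann algebra to an invariant closed subspace. -/
noncomputable def restrictRep (M : VonNeumannAlgebra H) (K : Submodule ℂ H) [CompleteSpace K]
    (hK : ∀ x ∈ M, ∀ v ∈ K, x v ∈ K) : M.toStarSubalgebra →⋆ₐ[ℂ] (K →L[ℂ] K) where
  toFun x := ((x : H →L[ℂ] H) ∘L K.subtypeL).codRestrict K fun v => hK x x.2 v v.2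
  map_one' := rfl
  map_mul' _ _ := rfl
  map_zero' := rfl
  map_add' _ _ := rfl
  commutes' _ := rfl
  map_star' x := by
    refine (ContinuousLinearMap.eq_adjoint_iff _ _).2 fun v w => ?_
    exact ContinuousLinearMap.adjoint_inner_left (x : H →L[ℂ] H) (w : H) (v : H)

theorem isNormalRep_restrictRep (M : VonNeumannAlgebra H) (K : Submodule ℂ H) [CompleteSpace K]
    (hK : ∀ x ∈ M, ∀ v ∈ K, x v ∈ K) : M.IsNormalRep (M.restrictRep K hK) := by
  refine continuous_iInf_rng.2 fun ξ => continuous_iInf_rng.2 fun η =>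
    continuous_iInf_rng.2 fun hξ => continuous_iInf_rng.2 fun hη => continuous_induced_rng.2 ?_
  convert M.continuous_weakStar (M.tsum_vectorFunctional_mem_predual
    (ξ := fun n => (ξ n : H)) (η := fun n => (η n : H)) hξ hη) using 1
  ext x
  exact (M.tsum_vectorFunctional_apply (ξ := fun n => (ξ n : H)) (η := fun n => (η n : H))
    hξ hη x).symm

/-- The von Neumann algebra generated by a self-adjoint set of operators. -/
noncomputable def bicommutant (S : Set (H →L[ℂ] H)) : VonNeumannAlgebra H where
  toStarSubalgebra := StarSubalgebra.centralizer ℂ (StarSubalgebra.centralizer ℂ S : Set (H →L[ℂ] H))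
  centralizer_centralizer' := by
    change Set.centralizer (Set.centralizer (StarSubalgebra.centralizer ℂ
      (StarSubalgebra.centralizer ℂ S : Set (H →L[ℂ] H)) : Set (H →L[ℂ] H))) =
      (StarSubalgebra.centralizer ℂ
        (StarSubalgebra.centralizer ℂ S : Set (H →L[ℂ] H)) : Set (H →L[ℂ] H))
    rw [StarSubalgebra.coe_centralizer_centralizer, Set.centralizer_centralizer_centralizer]

theorem coe_bicommutant (S : Set (H →L[ℂ] H)) :
    (bicommutant S : Set (H →L[ℂ] H)) = Set.centralizer (Set.centralizer (S ∪ star S)) :=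
  StarSubalgebra.coe_centralizer_centralizer ℂ S

theorem hasFaithfulSeparableRep_of_isCountablyGenerated {M : VonNeumannAlgebra H}
    (hd : M.IsCountablyDecomposable) (h : M.IsCountablyGenerated) :
    M.HasFaithfulSeparableRep := by
  obtain ⟨S, hSc, hSM, hS⟩ := h
  obtain ⟨X, hXc, hX⟩ := hd.exists_countable_separating
  let T : Set (H →L[ℂ] H) := S ∪ star S
  have hTc : T.Countable := hSc.union (by rw [← Set.image_star]; exact hSc.image _)
  have hTstar : ∀ t ∈ T, star t ∈ T := fun t ht => ht.symm.imp (fun h => h) (by simp)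
  -- A monoid of words stays countable, the span supplying linear combinations; its unit ensures
  -- that `K` contains `X`.
  let C : Set (H →L[ℂ] H) := Submonoid.closure T
  let K := cyclicSubspace C X
  have hPK : K.starProjection ∈ Set.centralizer T :=
    starProjection_mem_centralizer hTstar fun t ht v hv =>
      map_mem_cyclicSubspace (fun s hs => mul_mem (Submonoid.subset_closure ht) hs) hv
  have hK : ∀ x ∈ M, ∀ v ∈ K, x v ∈ K := fun x hx v hv => by
    -- Minimality of `M` places it inside the bicommutant of `S`, so its elements commute with the
    -- projection onto `K`.
    have hx' : x ∈ (bicommutant S : Set (H →L[ℂ] H)) := hS (bicommutant S) (by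
      rw [coe_bicommutant]
      exact Set.subset_union_left.trans Set.subset_centralizer_centralizer) hx
    rw [coe_bicommutant] at hx'
    have hc := DFunLike.congr_fun (hx' _ hPK) v
    rw [mul_apply_eq_comp, mul_apply_eq_comp, Submodule.starProjection_eq_self_iff.2 hv] at hc
    exact Submodule.starProjection_eq_self_iff.1 hc
  refine ⟨K, inferInstance, inferInstance, inferInstance, M.restrictRep K hK,
    separableSpace_cyclicSubspace hTc.submonoidClosure hXc, ?_, M.isNormalRep_restrictRep K hK⟩
  rw [injective_iff_map_eq_zero]
  intro x hx
  refine Subtype.ext (hX x x.2 fun ξ hξ => ?_)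
  have hξK : ξ ∈ K := apply_mem_cyclicSubspace (a := 1) (one_mem _) hξ
  exact congrArg Subtype.val (DFunLike.congr_fun hx (⟨ξ, hξK⟩ : K))

end VonNeumannAlgebra

theorem theoremI8 {H : Type*} [NormedAddCommGroup H] [InnerProductSpace ℂ H] [CompleteSpace H]
    (M : VonNeumannAlgebra H) :
    List.TFAE
      [ M.HasFaithfulSeparableRep,
        TopologicalSpace.SeparableSpace M.predual,
        M.IsCountablyDecomposable ∧ M.IsWeakStarSeparable,
        M.IsCountablyDecomposable ∧ M.HasSeparableDenseCStarSubalgebra,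
        M.IsCountablyDecomposable ∧ M.IsCountablyGenerated ] := by
  tfae_have 1 → 2 := VonNeumannAlgebra.separableSpace_predual_of_hasFaithfulSeparableRep
  tfae_have 2 → 3 := fun h =>
    ⟨VonNeumannAlgebra.isCountablyDecomposable_of_separableSpace_predual h,
      VonNeumannAlgebra.isWeakStarSeparable_of_separableSpace_predual h⟩
  tfae_have 3 → 4 := fun h =>
    ⟨h.1, VonNeumannAlgebra.hasSeparableDenseCStarSubalgebra_of_isWeakStarSeparable h.2⟩
  tfae_have 4 → 5 := fun h =>
    ⟨h.1, VonNeumannAlgebra.isCountablyGenerated_of_hasSeparableDenseCStarSubalgebra h.2⟩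
  tfae_have 5 → 1 := fun h =>
    VonNeumannAlgebra.hasFaithfulSeparableRep_of_isCountablyGenerated h.1 h.2
  tfae_finish
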